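/- Let $A$ be a finite-dimensional (associative, unital, not necessarily commutative) algebra over a field $k$. For a left $A$-module $M$ let $M^*=\operatorname{Hom}_A(M,A)$, a right $A$-module, and let $t(M)$ be the kernel of the canonical map $M\to M^{**}=\operatorname{Hom}_A(M^*,A)$, $m\mapsto(\varphi\mapsto\varphi(m))$. The grade of a left $A$-module $X$ is $$\operatorname{grade}(X)=\inf\{n\ge 0 : \operatorname{Ext}^n_A(X,A)\ne 0\}\in\mathbb{N}\cup\{\infty\},\qquad \operatorname{Ext}^0_A(X,A)=\operatorname{Hom}_A(X,A),\ \inf\emptyset=\infty,$$ so that $\operatorname{grade}(0)=\infty$. Let $0\to A\to I_0\to I_1\to\cdots$ be a minimal injective coresolution of the left $A$-module $A$. The dominant dimension $\operatorname{domdim}A\in\mathbb{N}\cup\{\infty\}$ is the supremum of all $n\ge 0$ such that $I_0,\dots,I_{n-1}$ are projective. **Theorem.** If $\operatorname{domdim}A\ge 1$, then $$\operatorname{domdim}A=\inf_{M,\; i\ge 1}\operatorname{grade}\bigl(\operatorname{Ext}^i_A(M,A)\bigr)=\inf_{N}\operatorname{grade}\bigl(t(N)\bigr)=\inf_{S}\operatorname{grade}\bigl(t(S)\bigr),$$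 where $M$ runs over the finitely generated right $A$-modules, $N$ over the finitely generated left $A$-modules and $S$ over the simple left $A$-modules; here $\operatorname{Ext}^i_A(M,A)$, for a right $A$-module $M$, is a left $A$-module through left multiplication on $A$. -/

import Mathlib

open CategoryTheory

universe u v

namespace DomDim

section Torsion

variable (A : Type u) [Ring A] (M : Type u) [AddCommGroup M] [Module A M]

/-- The left `A`-dual `M* = Hom_A(M, A)` of a left `A`-module `M`. It is a right `A`-module
(a left module over `Aᵐᵒᵖ`) through `(φ • a) m = φ m * a`. -/
abbrev Dual : Type u := M →ₗ[A] A

/-- The double dual `M** = Hom_A(M*, A)`, homomorphisms of right `A`-modules. It is a left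
`A`-module through `(a • ψ) φ = a * ψ φ`. -/
abbrev DoubleDual : Type u := Dual A M →ₗ[Aᵐᵒᵖ] A

/-- The canonical homomorphism `M → M**` of left `A`-modules, `m ↦ (φ ↦ φ m)`. -/
def evalMap : M →ₗ[A] DoubleDual A M where
  toFun m :=
    { toFun := fun φ => φ m
      map_add' := fun _ _ => rfl
      map_smul' := fun _ _ => rfl }
  map_add' x y := by ext φ; exact φ.map_add x y
  map_smul' a x := by ext φ; exact φ.map_smul a x

/-- `t(M)`, the kernel of the canonical map `M → M**`. -/
def torsion : Submodule A M := LinearMap.ker (evalMap A M)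

end Torsion

section Grade

/-- The grade of a left `A`-module `M`: the infimum of all `n ≥ 0` with `Ext_A^n(M, A) ≠ 0`.
It is `⊤` if there is no such `n`, in particular if `M = 0`. -/
noncomputable def grade (A : Type u) [Ring A] (M : Type u) [AddCommGroup M] [Module A M] : ℕ∞ :=
  ⨅ (n : ℕ) (_ : Nontrivial (Abelian.Ext (ModuleCat.of A M) (ModuleCat.of A A) n)), (n : ℕ∞)

end Grade

section Ext

variable (A : Type u) [Ring A]

/-- Left multiplication by `a`, an endomorphism of the right `A`-module `A`. -/
def leftMul (a : A) : ModuleCat.of Aᵐᵒᵖ A ⟶ ModuleCat.of Aᵐᵒᵖ A :=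
  ModuleCat.ofHom
    { toFun := fun x => a * x
      map_add' := fun x y => mul_add a x y
      map_smul' := fun r x => (mul_assoc a x r.unop).symm }

/-- `Ext_A^i(M, A)` for a right `A`-module `M`, computed in the category of right modules. -/
def ExtReg (M : ModuleCat.{u} Aᵐᵒᵖ) (i : ℕ) : Type u :=
  Abelian.Ext M (ModuleCat.of Aᵐᵒᵖ A) i

noncomputable instance (M : ModuleCat.{u} Aᵐᵒᵖ) (i : ℕ) : AddCommGroup (ExtReg A M i) :=
  inferInstanceAs (AddCommGroup (Abelian.Ext M (ModuleCat.of Aᵐᵒᵖ A) i))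

/-- The left `A`-module structure of `Ext_A^i(M, A)`: `a` acts through functoriality in the
second variable, applied to the left multiplication by `a` on `A`. -/
noncomputable instance (M : ModuleCat.{u} Aᵐᵒᵖ) (i : ℕ) : Module A (ExtReg A M i) where
  smul a x := Abelian.Ext.comp (Z := ModuleCat.of Aᵐᵒᵖ A) x
    (Abelian.Ext.mk₀ (leftMul A a)) (add_zero i)
  one_smul x := by
    have h : leftMul A 1 = 𝟙 _ :=
      ModuleCat.hom_ext (LinearMap.ext fun y : A => one_mul y)
    change Abelian.Ext.comp x (Abelian.Ext.mk₀ (leftMul A 1)) (add_zero i) = x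
    rw [h]
    exact Abelian.Ext.comp_mk₀_id x
  mul_smul a b x := by
    have h : leftMul A (a * b) = leftMul A b ≫ leftMul A a :=
      ModuleCat.hom_ext (LinearMap.ext fun y : A => mul_assoc a b y)
    change Abelian.Ext.comp x (Abelian.Ext.mk₀ (leftMul A (a * b))) (add_zero i) =
      Abelian.Ext.comp (Abelian.Ext.comp x (Abelian.Ext.mk₀ (leftMul A b)) (add_zero i))
        (Abelian.Ext.mk₀ (leftMul A a)) (add_zero i)
    rw [h, ← Abelian.Ext.mk₀_comp_mk₀]
    exact (Abelian.Ext.comp_assoc_of_third_deg_zero _ _ _ _).symm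
  smul_zero a := Abelian.Ext.zero_comp M i _ i (add_zero i)
  smul_add a x y := Abelian.Ext.add_comp _ _ _ _
  add_smul a b x := by
    have h : leftMul A (a + b) = leftMul A a + leftMul A b :=
      ModuleCat.hom_ext (LinearMap.ext fun y : A => add_mul a b y)
    change Abelian.Ext.comp x (Abelian.Ext.mk₀ (leftMul A (a + b))) (add_zero i) =
      Abelian.Ext.comp x (Abelian.Ext.mk₀ (leftMul A a)) (add_zero i) +
        Abelian.Ext.comp x (Abelian.Ext.mk₀ (leftMul A b)) (add_zero i)
    rw [h, Abelian.Ext.mk₀_add]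
    exact Abelian.Ext.comp_add _ _ _ _
  zero_smul x := by
    have h : leftMul A 0 = 0 :=
      ModuleCat.hom_ext (LinearMap.ext fun y : A => zero_mul y)
    change Abelian.Ext.comp x (Abelian.Ext.mk₀ (leftMul A 0)) (add_zero i) = 0
    rw [h, Abelian.Ext.mk₀_zero]
    exact Abelian.Ext.comp_zero _ _ _ _ _

end Ext

section DominantDimension

/-- A submodule `N` of `M` is essential if it meets every non-zero submodule of `M`. -/
def IsEssential {A : Type u} [Ring A] {M : Type u} [AddCommGroup M] [Module A M]
    (N : Submodule A M) : Prop :=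
  ∀ K : Submodule A M, N ⊓ K = ⊥ → K = ⊥

/-- An injective coresolution `0 → M → I⁰ → I¹ → ⋯` is minimal if, for every `n`, the kernel of
`Iⁿ → Iⁿ⁺¹` is essential in `Iⁿ`. By exactness this kernel is the image of `M` for `n = 0`, and
the image of `Iⁿ⁻¹` for `n ≥ 1`, so the condition says that `Iⁿ` is its injective hull. -/
def IsMinimal {A : Type u} [Ring A] {M : ModuleCat.{u} A} (I : InjectiveResolution M) : Prop :=
  ∀ n : ℕ, IsEssential (LinearMap.ker (I.cocomplex.d n (n + 1)).hom)

/-- The dominant dimension of a left `A`-module `M`: the supremum of all `n` such that the terms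
`I⁰, …, Iⁿ⁻¹` of a minimal injective coresolution of `M` are projective. Minimal injective
coresolutions are unique up to isomorphism, so it does not matter which one is used. -/
noncomputable def domDim (A : Type u) [Ring A] (M : Type u) [AddCommGroup M] [Module A M] : ℕ∞ :=
  ⨆ (n : ℕ) (_ : ∃ I : InjectiveResolution (ModuleCat.of A M), IsMinimal I ∧
    ∀ i < n, Module.Projective A (I.cocomplex.X i)), (n : ℕ∞)

end DominantDimension

end DomDim

/-!
Let `0 → A → I⁰ → I¹ → ⋯` be a minimal injective coresolution with `I⁰` projective; it exists as the
dominant dimension is at least `1`. The proof compares all infima through the left modules `X` with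
`X* = Hom(X, A) = 0`.

* Every such `X` satisfies `domdim A ≤ grade X` (`domDim_le_grade`), because a projective `Iⁱ`
  embeds in a free module, so that `Hom(X, Iⁱ) = 0`.
* The modules `t(N)` (`dual_torsion_eq_zero`) and `Ext^i(M, A)` for `i ≥ 1` and `M` finitely
  generated (`dual_extReg_eq_zero`) have zero dual. Both facts use that `A` embeds in `I⁰`, which is
  injective and whose points are separated by functionals.
* Conversely, simple modules with zero dual are enough to detect the dominant dimension
  (`le_domDim_of_forall_simple`). By minimality `Ext^i(S, A) = Hom(S, Iⁱ)` for `S` simple. If these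
  groups vanish for all `S` with `S* = 0`, the simple submodules of `Iⁱ` embed in `A`, hence in
  `I⁰`. Then `Iⁱ` is a summand of a direct sum of copies of `I⁰` (`projective_of_forall_simple`).
* A simple `S` with `S* = 0` equals `t(S)`, and is `Ext¹(M, A)` for the transpose `M` of `S`
  (`exists_extReg_linearEquiv`).
-/

namespace DomDim

/-! ### Modules with zero dual, and rings that embed in a projective injective module -/

section Modules

variable {A : Type u} [Ring A]

lemma eq_zero_of_forall_dual_eq_zero {P : Type*} [AddCommGroup P] [Module A P]
    [Module.Projective A P] {p : P} (hp : ∀ f : P →ₗ[A] A, f p = 0) : p = 0 := by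
  obtain ⟨s, hs⟩ := Module.projective_def.1 ‹Module.Projective A P›
  have h : s p = 0 := Finsupp.ext fun i => hp ((Finsupp.lapply i) ∘ₗ s)
  simpa [h] using (hs p).symm

variable (A) in
/-- The isomorphism of right `A`-modules `Aᵐᵒᵖ ≃ A`. -/
def unopEquiv : Aᵐᵒᵖ ≃ₗ[Aᵐᵒᵖ] A where
  toFun := MulOpposite.unop
  invFun := MulOpposite.op
  map_add' _ _ := rfl
  map_smul' _ _ := rfl

lemma eq_zero_of_forall_op_dual_eq_zero {P : Type*} [AddCommGroup P] [Module Aᵐᵒᵖ P]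
    [Module.Projective Aᵐᵒᵖ P] {p : P} (hp : ∀ f : P →ₗ[Aᵐᵒᵖ] A, f p = 0) : p = 0 := by
  exact eq_zero_of_forall_dual_eq_zero fun f =>
    MulOpposite.unop_injective (hp ((unopEquiv A).toLinearMap ∘ₗ f))

lemma hom_projective_eq_zero_of_dual_eq_zero {X P : Type*} [AddCommGroup X] [Module A X]
    [AddCommGroup P] [Module A P] [Module.Projective A P] (hX : ∀ f : X →ₗ[A] A, f = 0) (f : X →ₗ[A] P) :
    f = 0 :=
  LinearMap.ext fun x => eq_zero_of_forall_dual_eq_zero fun g =>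
    LinearMap.congr_fun (hX (g ∘ₗ f)) x

-- In the application `E = I⁰` is the first term of a minimal injective coresolution of `A`.
variable {E : Type u} [AddCommGroup E] [Module A E] [Module.Injective A E]

/-- `t(M)` has zero dual: a map `t(M) → A ⊆ E` extends to `M → E`, and a map from `M` to the
projective module `E` vanishes on `t(M)`, since functionals separate the points of `E`. -/
lemma dual_torsion_eq_zero [Module.Projective A E] {j : A →ₗ[A] E} (hj : Function.Injective j)
    (M : Type u) [AddCommGroup M] [Module A M] (f : torsion A M →ₗ[A] A) : f = 0 := by
  obtain ⟨F, hF⟩ := Module.Injective.extension_property A E (torsion A M) M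
    (torsion A M).subtype (torsion A M).injective_subtype (j ∘ₗ f)
  ext x
  apply hj
  have hx : F x = j (f x) := LinearMap.congr_fun hF x
  rw [LinearMap.zero_apply, map_zero, ← hx]
  exact eq_zero_of_forall_dual_eq_zero fun g => LinearMap.congr_fun
    (LinearMap.mem_ker.1 x.2) (g ∘ₗ F)

/-- For a finitely generated right submodule `K` of a projective module `P`, a functional `ψ` on
`K*` that kills the restrictions of functionals on `P` is zero; equivalently, the cokernel
`Ext¹(P/K, A)` of `P* → K*` has zero dual. -/
lemma dual_dual_eq_zero [Module.Projective A E] {j : A →ₗ[A] E} (hj : Function.Injective j)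
    {K P : Type*} [AddCommGroup K] [Module Aᵐᵒᵖ K] [Module.Finite Aᵐᵒᵖ K]
    [AddCommGroup P] [Module Aᵐᵒᵖ P] [Module.Projective Aᵐᵒᵖ P]
    {i : K →ₗ[Aᵐᵒᵖ] P} (hi : Function.Injective i)
    {ψ : (K →ₗ[Aᵐᵒᵖ] A) →ₗ[A] A} (hψ : ∀ φ : P →ₗ[Aᵐᵒᵖ] A, ψ (φ ∘ₗ i) = 0) : ψ = 0 := by
  obtain ⟨n, k, hk⟩ := Module.Finite.exists_fin (R := Aᵐᵒᵖ) (M := K)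
  -- Evaluation at generators embeds `K*` into `Aⁿ`, so that `ψ`, viewed in `E`, extends to `Aⁿ`.
  let ev : (K →ₗ[Aᵐᵒᵖ] A) →ₗ[A] (Fin n → A) :=
    { toFun := fun φ l => φ (k l)
      map_add' := fun _ _ => rfl
      map_smul' := fun _ _ => rfl }
  have hev : Function.Injective ev := fun φ φ' h =>
    LinearMap.ext_on_range hk fun l => congr_fun h l
  obtain ⟨F, hF⟩ := Module.Injective.extension_property A E _ _ ev hev (j ∘ₗ ψ)
  ext φ
  apply hj
  rw [LinearMap.zero_apply, map_zero]
  refine eq_zero_of_forall_dual_eq_zero (A := A) fun π => ?_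
  -- Followed by a functional `π` on `E`, the extension is evaluation at an element `x` of `K`.
  -- Functionals on `P` kill `x`, hence `x = 0`.
  let x : K := ∑ l, MulOpposite.op (π (F (Pi.single l 1))) • k l
  have key (φ : K →ₗ[Aᵐᵒᵖ] A) : φ x = π (j (ψ φ)) := by
    have h1 : j (ψ φ) = F (ev φ) := (LinearMap.congr_fun hF φ).symm
    have h2 : ev φ = ∑ l, φ (k l) • (Pi.single l 1 : Fin n → A) := by
      rw [pi_eq_sum_univ' (ev φ)]; rfl
    rw [h1, h2]
    simp [x]
  have hx : x = 0 := by
    apply hi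
    rw [map_zero]
    exact eq_zero_of_forall_op_dual_eq_zero fun g => by
      simpa [hψ g] using key (g ∘ₗ i)
  rw [← key φ, hx, map_zero]

/-- Over a noetherian ring direct sums of copies of an injective module are injective: in Baer's
criterion, the image of a finitely generated left ideal lies in a finite subsum. -/
lemma injective_dfinsupp [IsNoetherianRing A] (ι : Type u) :
    Module.Injective A (Π₀ _ : ι, E) := by
  classical
  refine Module.Baer.injective fun I g => ?_
  obtain ⟨n, x, hx⟩ := Module.Finite.exists_fin (R := A) (M := I)
  let s : Finset ι := Finset.univ.biUnion fun l => (g (x l)).support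
  have hs (y : I) (i : ι) (hi : i ∉ s) : g y i = 0 := by
    have h : (DFinsupp.lapply i : (Π₀ _ : ι, E) →ₗ[A] E) ∘ₗ g = 0 := by
      refine LinearMap.ext_on_range hx fun l => ?_
      by_contra h
      exact hi (Finset.mem_biUnion.2 ⟨l, Finset.mem_univ _, DFinsupp.mem_support_iff.2 h⟩)
    exact LinearMap.congr_fun h y
  choose h hh using fun i => Module.Injective.extension_property A E I A I.subtype
    I.injective_subtype ((DFinsupp.lapply i : (Π₀ _ : ι, E) →ₗ[A] E) ∘ₗ g)
  refine ⟨∑ i ∈ s, (DFinsupp.lsingle (M := fun _ : ι => E) i : E →ₗ[A] Π₀ _ : ι, E) ∘ₗ h i,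
    fun y hy => ?_⟩
  have hh' (i : ι) : h i y = g ⟨y, hy⟩ i := LinearMap.congr_fun (hh i) ⟨y, hy⟩
  ext i
  by_cases hi : i ∈ s
  · simp [hh', DFinsupp.single_apply, hi]
  · rw [hs _ i hi]
    simp [DFinsupp.single_apply, hi]

lemma exists_isSimpleModule_le [IsArtinianRing A] {M : Type*} [AddCommGroup M] [Module A M]
    {N : Submodule A M} (hN : N ≠ ⊥) : ∃ S ≤ N, IsSimpleModule A S := by
  obtain ⟨x, hx, hx0⟩ := N.ne_bot_iff.1 hN
  have hle : Submodule.span A {x} ≤ N := (Submodule.span_singleton_le_iff_mem _ _).2 hx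
  have : IsArtinian A (Submodule.span A {x}) := isArtinian_span_of_finite A (Set.finite_singleton x)
  obtain h | ⟨T, hT, -⟩ := IsAtomic.eq_bot_or_exists_atom_le (⊤ : Submodule A (Submodule.span A {x}))
  · have hx' : (⟨x, Submodule.mem_span_singleton_self x⟩ : Submodule.span A {x}) ∈
        (⊤ : Submodule A (Submodule.span A {x})) := trivial
    rw [h, Submodule.mem_bot] at hx'
    exact absurd (congrArg Subtype.val hx') hx0
  · have := isSimpleModule_iff_isAtom.2 hT
    exact ⟨T.map (Submodule.subtype _), (Submodule.map_subtype_le _ _).trans hle,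
      IsSimpleModule.congr (Submodule.equivSubtypeMap _ T).symm⟩

/-- An injective module over an artinian ring is projective if each of its simple submodules has a
nonzero map to `A`: its socle embeds in a direct sum of copies of `E`, and the embedding extends to
a split embedding of the whole module. -/
lemma projective_of_forall_simple [IsArtinianRing A] [Module.Projective A E]
    {j : A →ₗ[A] E} (hj : Function.Injective j) {M : Type u} [AddCommGroup M] [Module A M]
    [Module.Injective A M]
    (hM : ∀ S : Submodule A M, IsSimpleModule A S → ∃ f : S →ₗ[A] A, f ≠ 0) :
    Module.Projective A M := by
  classical
  -- Write the socle as a direct sum of simple submodules.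
  obtain ⟨s, hs, -, hsup, hatom⟩ := exists_sSupIndep_disjoint_sSup_atoms (⊥ : Submodule A M)
    (sSup {a | IsAtom a}) bot_le (le_antisymm (sSup_le fun a ha => ha.1)
      (sSup_le fun a ha => le_sSup ⟨le_sSup ha, ha⟩))
  rw [bot_sup_eq] at hsup
  have hsimple (S : s) : IsSimpleModule A S.1 := isSimpleModule_iff_isAtom.2 (hatom S.2)
  choose f hf using fun S : s => hM S.1 (hsimple S)
  let c : (Π₀ S : s, S.1) →ₗ[A] M := DFinsupp.lsum ℕ fun S : s => S.1.subtype
  have hc : Function.Injective c :=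
    iSupIndep.dfinsupp_lsum_injective ((sSupIndep_iff s).1 hs)
  let g : (Π₀ S : s, S.1) →ₗ[A] (Π₀ _ : s, E) := DFinsupp.mapRange.linearMap fun S => j ∘ₗ f S
  have hg : Function.Injective g := (DFinsupp.mapRange_injective _ fun _ => map_zero _).2 fun S =>
    hj.comp (LinearMap.injective_of_ne_zero (hf S))
  have := injective_dfinsupp (A := A) (E := E) s
  obtain ⟨h, hh⟩ := Module.Injective.extension_property A (Π₀ _ : s, E) _ _ c hc g
  -- A simple submodule of the kernel of `h` would lie in the socle, where `h` is injective.
  have hinj : Function.Injective h := by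
    rw [← LinearMap.ker_eq_bot]
    by_contra hne
    obtain ⟨S, hS, hSs⟩ := exists_isSimpleModule_le hne
    have hle : S ≤ LinearMap.range c := by
      have hS' : S ≤ sSup {a | IsAtom a} := le_sSup (isSimpleModule_iff_isAtom.1 hSs)
      refine hS'.trans ?_
      rw [← hsup, sSup_eq_iSup', Submodule.iSup_eq_range_dfinsupp_lsum]
    have : Nontrivial S := IsSimpleModule.nontrivial A S
    obtain ⟨x, hx⟩ := exists_ne (0 : S)
    obtain ⟨d, hd⟩ := hle x.2
    have hgd : g d = 0 := by
      rw [← hh, LinearMap.comp_apply, hd]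
      exact hS x.2
    rw [(map_eq_zero_iff g hg).1 hgd, map_zero] at hd
    exact hx (Subtype.ext hd.symm)
  obtain ⟨r, hr⟩ := Module.Injective.extension_property A M _ _ h hinj LinearMap.id
  exact Module.Projective.of_split h r hr

end Modules

/-! ### Grade and dominant dimension through minimal injective coresolutions -/

section LeftExt

variable {A : Type u} [Ring A] {X : Type u} [AddCommGroup X] [Module A X]

lemma le_grade {n : ℕ}
    (h : ∀ i < n, Subsingleton (Abelian.Ext (ModuleCat.of A X) (ModuleCat.of A A) i)) :
    (n : ℕ∞) ≤ grade A X := by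
  refine le_iInf₂ fun i hi => ?_
  by_contra hlt
  have := h i (by exact_mod_cast not_le.1 hlt)
  exact not_subsingleton _ this

lemma subsingleton_ext_of_lt_grade {i : ℕ} (h : (i : ℕ∞) < grade A X) :
    Subsingleton (Abelian.Ext (ModuleCat.of A X) (ModuleCat.of A A) i) := by
  by_contra hn
  rw [not_subsingleton_iff_nontrivial] at hn
  exact not_le.2 h (iInf₂_le i hn)

lemma grade_le_of_linearEquiv {Y : Type u} [AddCommGroup Y] [Module A Y] (e : X ≃ₗ[A] Y) :
    grade A X ≤ grade A Y := by
  refine ENat.forall_natCast_le_iff_le.1 fun n hn => le_grade fun i hi =>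
    subsingleton_of_forall_eq 0 fun y => ?_
  have := subsingleton_ext_of_lt_grade (lt_of_lt_of_le (by exact_mod_cast hi) hn)
  have h : (Abelian.Ext.mk₀ e.toModuleIso.inv).comp
      ((Abelian.Ext.mk₀ e.toModuleIso.hom).comp y (zero_add i)) (zero_add i) = y := by
    rw [Abelian.Ext.mk₀_comp_mk₀_assoc, Iso.inv_hom_id, Abelian.Ext.mk₀_id_comp]
  rw [← h, Subsingleton.elim ((Abelian.Ext.mk₀ e.toModuleIso.hom).comp y (zero_add i)) 0,
    Abelian.Ext.comp_zero]

/-- If `X* = 0`, there are no nonzero maps from `X` to the projective terms of an injective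
coresolution of `A`, and thus no nonzero cocycles computing `Ext^i(X, A)`. -/
lemma domDim_le_grade (hX : ∀ f : X →ₗ[A] A, f = 0) : domDim A A ≤ grade A X := by
  refine iSup₂_le fun n hn => ?_
  obtain ⟨I, -, hI⟩ := hn
  refine le_grade fun i hi => subsingleton_of_forall_eq 0 fun α => ?_
  have := hI i hi
  obtain ⟨f, hf, rfl⟩ := I.extMk_surjective α (i + 1) rfl
  obtain rfl : f = 0 := ModuleCat.hom_ext (hom_projective_eq_zero_of_dual_eq_zero hX f.hom)
  exact I.extMk_zero (i + 1) rfl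

/-- The differential of a minimal injective coresolution kills every map from a simple module: the
image of the map is zero or meets the kernel of the differential. -/
lemma comp_d_eq_zero_of_isSimpleModule [IsSimpleModule A X] {M : ModuleCat.{u} A}
    {I : InjectiveResolution M} (hI : IsMinimal I) {n : ℕ}
    (f : ModuleCat.of A X ⟶ I.cocomplex.X n) : f ≫ I.cocomplex.d n (n + 1) = 0 := by
  ext x
  let D := (I.cocomplex.d n (n + 1)).hom
  obtain h | h := eq_bot_or_eq_top (LinearMap.ker (D ∘ₗ f.hom))
  · have h0 := hI n (LinearMap.range f.hom) (by
      rw [Submodule.eq_bot_iff]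
      rintro _ ⟨hy, x, rfl⟩
      have hx : x ∈ LinearMap.ker (D ∘ₗ f.hom) := hy
      rw [h, Submodule.mem_bot] at hx
      rw [hx, map_zero])
    have : f.hom x = 0 := LinearMap.congr_fun (LinearMap.range_eq_bot.1 h0) x
    simp [this]
  · have : x ∈ LinearMap.ker (D ∘ₗ f.hom) := h ▸ Submodule.mem_top
    exact this

/-- For `X` simple, `Ext^n(X, M) = 0` forces `Hom(X, Iⁿ) = 0`: every map `X → Iⁿ` is a cocycle, and
a coboundary is zero as the differential kills the maps from `X`. -/
lemma hom_eq_zero_of_subsingleton_ext [IsSimpleModule A X] {M : ModuleCat.{u} A}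
    {I : InjectiveResolution M} (hI : IsMinimal I) {n : ℕ}
    (h : Subsingleton (Abelian.Ext (ModuleCat.of A X) M n))
    (hn : n ≠ 0) (f : ModuleCat.of A X ⟶ I.cocomplex.X n) : f = 0 := by
  obtain ⟨m, rfl⟩ := Nat.exists_eq_succ_of_ne_zero hn
  obtain ⟨g, hg⟩ := (I.extMk_eq_zero_iff f (m + 1 + 1) rfl
    (comp_d_eq_zero_of_isSimpleModule hI f) m rfl).1 (Subsingleton.elim _ _)
  rw [← hg]
  exact comp_d_eq_zero_of_isSimpleModule hI g

lemma injective_cocomplex {M : ModuleCat.{u} A} (I : InjectiveResolution M) (n : ℕ) :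
    Module.Injective A (I.cocomplex.X n) :=
  have : Injective (ModuleCat.of A (I.cocomplex.X n)) := I.injective n
  Module.injective_module_of_injective_object A _

lemma exists_injective_projective_of_one_le_domDim (hA : 1 ≤ domDim A A) :
    ∃ I : InjectiveResolution (ModuleCat.of A A), IsMinimal I ∧
      Module.Projective A (I.cocomplex.X 0) ∧
      ∃ j : A →ₗ[A] I.cocomplex.X 0, Function.Injective j := by
  have h0 : (0 : ℕ∞) < domDim A A := lt_of_lt_of_le zero_lt_one hA
  obtain ⟨n, hn⟩ := lt_iSup_iff.1 h0
  obtain ⟨⟨I, hI, hp⟩, hn⟩ := lt_iSup_iff.1 hn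
  exact ⟨I, hI, hp 0 (by exact_mod_cast hn), (I.ι.f 0).hom,
    (ModuleCat.mono_iff_injective (I.ι.f 0)).1 inferInstance⟩

/-- If all simple modules with zero dual have grade at least `n`, the simple submodules of `Iⁱ`,
`i < n`, have nonzero dual, and therefore `Iⁱ` is projective. -/
lemma le_domDim_of_forall_simple [IsArtinianRing A] (hA : 1 ≤ domDim A A) {n : ℕ}
    (h : ∀ (S : Type u) [AddCommGroup S] [Module A S], IsSimpleModule A S →
      (∀ f : S →ₗ[A] A, f = 0) → n ≤ grade A S) : n ≤ domDim A A := by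
  obtain ⟨I, hI, hp, j, hj⟩ := exists_injective_projective_of_one_le_domDim hA
  refine le_iSup₂_of_le n ⟨I, hI, fun i hi => ?_⟩ le_rfl
  obtain rfl | hi0 := eq_or_ne i 0
  · exact hp
  have inj := injective_cocomplex I
  refine projective_of_forall_simple hj fun S hS => ?_
  by_contra! hS0
  have hsub := subsingleton_ext_of_lt_grade (lt_of_lt_of_le (by exact_mod_cast hi) (h S hS hS0))
  have h0 := hom_eq_zero_of_subsingleton_ext hI hsub hi0 (ModuleCat.ofHom S.subtype)
  have : Nontrivial S := IsSimpleModule.nontrivial A S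
  obtain ⟨x, hx⟩ := exists_ne (0 : S)
  exact hx (Subtype.ext (LinearMap.congr_fun (ModuleCat.hom_ext_iff.1 h0) x))

end LeftExt

/-! ### The left modules `Ext^i(M, A)` of right modules `M` -/

section RightExt

variable (A : Type u) [Ring A]

/-- The connecting homomorphism `Ext^i(S₁, A) → Ext^(i+1)(S₃, A)` of a short exact sequence of right
modules, as a homomorphism of left `A`-modules. -/
noncomputable def connecting {S : ShortComplex (ModuleCat.{u} Aᵐᵒᵖ)} (hS : S.ShortExact) {i m : ℕ}
    (h : 1 + i = m) : ExtReg A S.X₁ i →ₗ[A] ExtReg A S.X₃ m where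
  toFun x := Abelian.Ext.comp (Z := ModuleCat.of Aᵐᵒᵖ A) hS.extClass x h
  map_add' _ _ := Abelian.Ext.comp_add _ _ _ _
  map_smul' _ _ := (Abelian.Ext.comp_assoc_of_third_deg_zero _ _ _ _).symm

/-- The identification of `Hom(M, A)` with `Ext⁰(M, A)`, as a homomorphism of left `A`-modules. -/
noncomputable def homToExt (M : ModuleCat.{u} Aᵐᵒᵖ) : (M →ₗ[Aᵐᵒᵖ] A) →ₗ[A] ExtReg A M 0 where
  toFun f := Abelian.Ext.mk₀ (Y := ModuleCat.of Aᵐᵒᵖ A) (ModuleCat.ofHom f)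
  map_add' _ _ := Abelian.Ext.mk₀_add _ _
  map_smul' a f := (Abelian.Ext.mk₀_comp_mk₀ (ModuleCat.ofHom f) (leftMul A a)).symm

lemma homToExt_surjective (M : ModuleCat.{u} Aᵐᵒᵖ) : Function.Surjective (homToExt A M) :=
  fun x => by
    obtain ⟨f, hf⟩ := (Abelian.Ext.mk₀_bijective M (ModuleCat.of Aᵐᵒᵖ A)).2 x
    exact ⟨f.hom, hf⟩

variable {A}

lemma connecting_surjective {S : ShortComplex (ModuleCat.{u} Aᵐᵒᵖ)} (hS : S.ShortExact)
    [Projective S.X₂] {i m : ℕ} (h : 1 + i = m) : Function.Surjective (connecting A hS h) := by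
  obtain rfl : i + 1 = m := by omega
  exact fun x => Abelian.Ext.contravariant_sequence_exact₃ hS _ x
    (Abelian.Ext.eq_zero_of_projective _) h

lemma connecting_homToExt_eq_zero_iff {S : ShortComplex (ModuleCat.{u} Aᵐᵒᵖ)} (hS : S.ShortExact)
    (f : S.X₁ →ₗ[Aᵐᵒᵖ] A) :
    connecting A hS (add_zero 1) (homToExt A S.X₁ f) = 0 ↔
      ∃ g : S.X₂ →ₗ[Aᵐᵒᵖ] A, g ∘ₗ S.f.hom = f := by
  constructor
  · intro h
    obtain ⟨x, hx⟩ := Abelian.Ext.contravariant_sequence_exact₁ hS _ _ (add_zero 1) h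
    obtain ⟨g, rfl⟩ := homToExt_surjective A S.X₂ x
    refine ⟨g, ?_⟩
    have hx' : Abelian.Ext.mk₀ (S.f ≫ ModuleCat.ofHom g) =
        Abelian.Ext.mk₀ (Y := ModuleCat.of Aᵐᵒᵖ A) (ModuleCat.ofHom f) :=
      (Abelian.Ext.mk₀_comp_mk₀ _ _).symm.trans hx
    exact ModuleCat.hom_ext_iff.1 ((Abelian.Ext.mk₀_bijective _ _).1 hx')
  · rintro ⟨g, rfl⟩
    change hS.extClass.comp (Abelian.Ext.mk₀ (S.f ≫ ModuleCat.ofHom g)) (add_zero 1) = 0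
    rw [← Abelian.Ext.mk₀_comp_mk₀]
    exact hS.extClass_comp_assoc _

lemma exists_finite_presentation (M : ModuleCat.{u} Aᵐᵒᵖ) [Module.Finite Aᵐᵒᵖ M] :
    ∃ S : ShortComplex (ModuleCat.{u} Aᵐᵒᵖ), S.ShortExact ∧ S.X₃ = M ∧
      Module.Finite Aᵐᵒᵖ S.X₂ ∧ Module.Projective Aᵐᵒᵖ S.X₂ := by
  obtain ⟨n, f, hf⟩ := Module.Finite.exists_fin' Aᵐᵒᵖ M
  exact ⟨f.shortComplexKer, LinearMap.shortExact_shortComplexKer hf, rfl,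
    inferInstanceAs (Module.Finite Aᵐᵒᵖ (Fin n → Aᵐᵒᵖ)),
    inferInstanceAs (Module.Projective Aᵐᵒᵖ (Fin n → Aᵐᵒᵖ))⟩

/-- `Ext^i(M, A)` has zero dual for `i ≥ 1` and `M` finitely generated. Dimension shifting reduces
this to `Ext¹`, the cokernel of `P* → K*` for a presentation `0 → K → P → M → 0`. -/
lemma dual_extReg_eq_zero [IsNoetherianRing Aᵐᵒᵖ] {E : Type u} [AddCommGroup E] [Module A E]
    [Module.Injective A E] [Module.Projective A E] {j : A →ₗ[A] E} (hj : Function.Injective j)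
    {i : ℕ} (M : ModuleCat.{u} Aᵐᵒᵖ) [Module.Finite Aᵐᵒᵖ M]
    (ξ : ExtReg A M (i + 1) →ₗ[A] A) : ξ = 0 := by
  induction i generalizing M with
  | zero =>
    obtain ⟨S, hS, rfl, hfin, hproj⟩ := exists_finite_presentation M
    have := (IsProjective.iff_projective (R := Aᵐᵒᵖ) S.X₂).1 hproj
    have hinj : Function.Injective S.f.hom := (ModuleCat.mono_iff_injective _).1 hS.mono_f
    have : Module.Finite Aᵐᵒᵖ S.X₁ := Module.Finite.of_injective S.f.hom hinj
    have h := dual_dual_eq_zero hj hinj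
      (ψ := ξ ∘ₗ connecting A hS (add_zero 1) ∘ₗ homToExt A S.X₁) fun φ => by
        have := (connecting_homToExt_eq_zero_iff hS (φ ∘ₗ S.f.hom)).2 ⟨φ, rfl⟩
        simp [this]
    refine LinearMap.ext fun x => ?_
    obtain ⟨y, rfl⟩ := connecting_surjective hS (add_zero 1) x
    obtain ⟨φ, rfl⟩ := homToExt_surjective A _ y
    exact LinearMap.congr_fun h φ
  | succ i ih =>
    obtain ⟨S, hS, rfl, hfin, hproj⟩ := exists_finite_presentation M
    have := (IsProjective.iff_projective (R := Aᵐᵒᵖ) S.X₂).1 hproj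
    have hinj : Function.Injective S.f.hom := (ModuleCat.mono_iff_injective _).1 hS.mono_f
    have : Module.Finite Aᵐᵒᵖ S.X₁ := Module.Finite.of_injective S.f.hom hinj
    have h := ih S.X₁ (ξ ∘ₗ connecting A hS (add_comm 1 (i + 1)))
    refine LinearMap.ext fun x => ?_
    obtain ⟨y, rfl⟩ := connecting_surjective hS (add_comm 1 (i + 1)) x
    exact LinearMap.congr_fun h y

/-- A simple module `S = A/(x₁, …, xₙ)` with zero dual is `Ext¹(M, A)` for its transpose `M`, the
cokernel of `A → Aⁿ`, `a ↦ (x₁ a, …, xₙ a)`. Indeed this map is injective as `S* = 0`, and its dual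
`Aⁿ → A` has image `(x₁, …, xₙ)`. -/
lemma exists_extReg_linearEquiv [IsNoetherianRing A] {S : Type u} [AddCommGroup S] [Module A S]
    (hS : IsSimpleModule A S) (h0 : ∀ f : S →ₗ[A] A, f = 0) :
    ∃ M : ModuleCat.{u} Aᵐᵒᵖ, Module.Finite Aᵐᵒᵖ M ∧ Nonempty (ExtReg A M 1 ≃ₗ[A] S) := by
  have := IsSimpleModule.nontrivial A S
  obtain ⟨s, hs⟩ := exists_ne (0 : S)
  let q : A →ₗ[A] S := LinearMap.toSpanSingleton A S s
  have hq : Function.Surjective q := IsSimpleModule.toSpanSingleton_surjective A hs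
  obtain ⟨n, x, hx⟩ := Submodule.fg_iff_exists_fin_generating_family.1
    (IsNoetherian.noetherian (LinearMap.ker q))
  let i : A →ₗ[Aᵐᵒᵖ] (Fin n → A) :=
    { toFun := fun a l => x l * a
      map_add' := fun a b => funext fun l => mul_add _ _ _
      map_smul' := fun r a => funext fun l => (mul_assoc (x l) a r.unop).symm }
  -- Right multiplication by an element of `ker i` factors through `S`.
  have hi : Function.Injective i := by
    rw [← LinearMap.ker_eq_bot, Submodule.eq_bot_iff]
    intro a ha
    have hle : LinearMap.ker q ≤ LinearMap.ker (LinearMap.toSpanSingleton A A a) := by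
      rw [← hx, Submodule.span_le]
      rintro _ ⟨l, rfl⟩
      exact congr_fun ha l
    let f : S →ₗ[A] A := (LinearMap.ker q).liftQ _ hle ∘ₗ
      (q.quotKerEquivOfSurjective hq).symm.toLinearMap
    have hf : f (q 1) = a := by
      have h1 : (q.quotKerEquivOfSurjective hq).symm (q 1) = (LinearMap.ker q).mkQ 1 := by
        rw [LinearEquiv.symm_apply_eq]; rfl
      simp [f, h1]
    rw [← hf, h0 f, LinearMap.zero_apply]
  let T : ShortComplex (ModuleCat.{u} Aᵐᵒᵖ) := ShortComplex.mk
    (ModuleCat.ofHom i) (ModuleCat.ofHom (LinearMap.range i).mkQ)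
    (ModuleCat.hom_ext (LinearMap.ext fun a => (Submodule.Quotient.mk_eq_zero _).2 ⟨a, rfl⟩))
  have hT : T.ShortExact :=
    { exact := (ShortComplex.ShortExact.moduleCat_exact_iff_function_exact _).2
        (LinearMap.exact_iff.2 (Submodule.ker_mkQ _))
      mono_f := (ModuleCat.mono_iff_injective _).2 hi
      epi_g := (ModuleCat.epi_iff_surjective _).2 (Submodule.mkQ_surjective _) }
  have hproj : Module.Projective Aᵐᵒᵖ (Fin n → A) :=
    Module.Projective.of_equiv' (LinearEquiv.piCongrRight fun _ => unopEquiv A)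
  have : Projective T.X₂ := (IsProjective.iff_projective (R := Aᵐᵒᵖ) (Fin n → A)).1 hproj
  let m : A →ₗ[A] (A →ₗ[Aᵐᵒᵖ] A) :=
    { toFun := fun a => (leftMul A a).hom
      map_add' := fun a b => LinearMap.ext fun y => add_mul a b y
      map_smul' := fun a b => LinearMap.ext fun y => mul_assoc a b y }
  have hm : Function.Surjective m := fun f => ⟨f 1, LinearMap.ext fun y => by
    exact (f.map_smul (MulOpposite.op y) 1).symm.trans (congrArg f (one_mul y))⟩
  -- `A ≃ Hom(A, A) → Ext¹(M, A)` is onto with the same kernel as `A → S`.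
  let p : A →ₗ[A] ExtReg A T.X₃ 1 := connecting A hT (add_zero 1) ∘ₗ homToExt A T.X₁ ∘ₗ m
  have hp : Function.Surjective p :=
    (connecting_surjective hT (add_zero 1)).comp ((homToExt_surjective A _).comp hm)
  have hker : LinearMap.ker p = LinearMap.ker q := by
    ext a
    rw [LinearMap.mem_ker]
    refine (connecting_homToExt_eq_zero_iff hT (m a)).trans ?_
    rw [← hx, Submodule.mem_span_range_iff_exists_fun]
    constructor
    · rintro ⟨g, hg⟩
      have hg1 : g (i 1) = a := (LinearMap.congr_fun hg 1).trans (mul_one a)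
      refine ⟨fun l => g (Pi.single l 1 : Fin n → A), ?_⟩
      have hi1 : i 1 = ∑ l, MulOpposite.op (x l) • (Pi.single l 1 : Fin n → A) := by
        rw [pi_eq_sum_univ' (i 1)]
        exact Finset.sum_congr rfl fun l _ => by ext; simp [i, Pi.single_apply]
      rw [← hg1, hi1, map_sum]
      exact Finset.sum_congr rfl fun l _ => (map_smul g _ _).symm
    · rintro ⟨c, hc⟩
      refine ⟨∑ l, (leftMul A (c l)).hom ∘ₗ LinearMap.proj l, LinearMap.ext fun y => ?_⟩
      change (∑ l, (leftMul A (c l)).hom ∘ₗ LinearMap.proj l) (i y) = a * y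
      rw [← hc, Finset.sum_mul, LinearMap.sum_apply]
      exact Finset.sum_congr rfl fun l _ => (mul_assoc (c l) (x l) y).symm
  have hfin : Module.Finite Aᵐᵒᵖ (Fin n → A) :=
    Module.Finite.equiv (LinearEquiv.piCongrRight fun _ : Fin n => unopEquiv A)
  exact ⟨T.X₃, inferInstanceAs (Module.Finite Aᵐᵒᵖ ((Fin n → A) ⧸ LinearMap.range i)),
    ⟨(p.quotKerEquivOfSurjective hp).symm.trans
      ((Submodule.quotEquivOfEq _ _ hker).trans (q.quotKerEquivOfSurjective hq))⟩⟩

end RightExt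
end DomDim

open DomDim in
theorem theorem4p5 {k : Type v} [Field k] {A : Type u} [Ring A] [Algebra k A] [Module.Finite k A]
    (hA : 1 ≤ DomDim.domDim A A) :
    DomDim.domDim A A =
        (⨅ (M : ModuleCat.{u} Aᵐᵒᵖ) (_ : Module.Finite Aᵐᵒᵖ M) (i : ℕ) (_ : 1 ≤ i),
          DomDim.grade A (DomDim.ExtReg A M i)) ∧
    DomDim.domDim A A =
        (⨅ (M : ModuleCat.{u} A) (_ : Module.Finite A M),
          DomDim.grade A (DomDim.torsion A M)) ∧
    DomDim.domDim A A =
        (⨅ (S : ModuleCat.{u} A) (_ : IsSimpleModule A S),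
          DomDim.grade A (DomDim.torsion A S)) := by
  have hnoeth : IsNoetherianRing A := isNoetherian_of_tower k inferInstance
  have hart : IsArtinianRing A := isArtinian_of_tower k inferInstance
  have hnoethop : IsNoetherianRing Aᵐᵒᵖ := isNoetherian_of_tower k inferInstance
  obtain ⟨I, -, hproj, j, hj⟩ := exists_injective_projective_of_one_le_domDim hA
  have := injective_cocomplex I 0
  have h1 : domDim A A ≤ ⨅ (M : ModuleCat.{u} Aᵐᵒᵖ) (_ : Module.Finite Aᵐᵒᵖ M) (i : ℕ)
      (_ : 1 ≤ i), grade A (ExtReg A M i) := by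
    refine le_iInf₂ fun M hM => le_iInf₂ fun i hi => ?_
    obtain ⟨i, rfl⟩ := Nat.exists_eq_add_of_le' hi
    exact domDim_le_grade (dual_extReg_eq_zero hj M)
  have h2 : domDim A A ≤ ⨅ (M : ModuleCat.{u} A) (_ : Module.Finite A M),
      grade A (torsion A M) :=
    le_iInf₂ fun M _ => domDim_le_grade (dual_torsion_eq_zero hj M)
  have h3 : (⨅ (M : ModuleCat.{u} A) (_ : Module.Finite A M), grade A (torsion A M)) ≤
      ⨅ (S : ModuleCat.{u} A) (_ : IsSimpleModule A S), grade A (torsion A S) :=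
    le_iInf₂ fun S _ =>
      iInf₂_le S (inferInstanceAs (Module.Finite A S))
  have h4 : (⨅ (S : ModuleCat.{u} A) (_ : IsSimpleModule A S), grade A (torsion A S)) ≤
      domDim A A := by
    refine ENat.forall_natCast_le_iff_le.1 fun n hn =>
      le_domDim_of_forall_simple hA fun S _ _ hS hS0 => ?_
    have htop : torsion A S = ⊤ := by
      refine LinearMap.ker_eq_top.2 ?_
      ext x f
      exact LinearMap.congr_fun (hS0 f) x
    exact (hn.trans (iInf₂_le (ModuleCat.of A S) hS)).trans
      (grade_le_of_linearEquiv ((LinearEquiv.ofEq _ _ htop).trans Submodule.topEquiv))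
  have h5 : (⨅ (M : ModuleCat.{u} Aᵐᵒᵖ) (_ : Module.Finite Aᵐᵒᵖ M) (i : ℕ)
      (_ : 1 ≤ i), grade A (ExtReg A M i)) ≤ domDim A A := by
    refine ENat.forall_natCast_le_iff_le.1 fun n hn =>
      le_domDim_of_forall_simple hA fun S _ _ hS hS0 => ?_
    obtain ⟨M, hM, ⟨e⟩⟩ := exists_extReg_linearEquiv hS hS0
    exact (hn.trans ((iInf₂_le M hM).trans (iInf₂_le 1 le_rfl))).trans
      (grade_le_of_linearEquiv e)
  exact ⟨h1.antisymm h5, h2.antisymm (h3.trans h4), (h2.trans h3).antisymm h4⟩
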